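/- Let $n\ge 3$, let $B=B(0,1)$ be the open unit ball of $\mathbb{R}^n$, let $q<\frac n2-1$ be real, and put $A(t)=t^{n/2}\log(e+t)^q$ for $t\ge 0$. Let $L^A(B)$ be the space of measurable $h:B\to\mathbb{R}$ with finite Luxemburg norm $$\|h\|_{L^A(B)}=\inf\Big\{\lambda>0:\int_B A\Big(\frac{|h(x)|}{\lambda}\Big)\,dx\le 1\Big\}.$$ Let $H^1_0(B)$ be the set of pairs $(u,\nabla u)\in L^2(B)\times L^2(B;\mathbb{R}^n)$ that are limits in $L^2(B)\times L^2(B;\mathbb{R}^n)$ of pairs $(\psi_j,\nabla\psi_j)$, where each $\psi_j$ belongs to the set $\mathrm{Lip}_0(B)$ of Lipschitz functions with compact support in $B$. A weak solution of $$-\Delta u=f\ \text{ in }B,\qquad u=0\ \text{ on }\partial B$$ is a pair $(u,\nabla u)\in H^1_0(B)$ with $\int_B\nabla\psi\cdot\nabla u\,dx=\int_B f\psi\,dx$ for every $\psi\in \mathrm{Lip}_0(B)$ (where $f\psi\in L^1(B)$ is required); it is non-negative if $u\ge 0$ a.e. in $B$. Then there is a function $f\in L^A(B)$, namely $$f(x)=|x|^{-2}\log(e+|x|^{-1})^{-1},$$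 for which this problem has a weak solution that is unique (up to null sets), non-negative, and unbounded: $\|u\|_{L^\infty(B)}=\infty$. In particular, there is no finite constant $C$ such that $\|u\|_{L^\infty(B)}\le C\|f\|_{L^A(B)}$ for all $f\in L^A(B)$ and all non-negative weak solutions $u$ of this problem. -/

import Mathlib

open MeasureTheory Filter Topology
open scoped ENNReal NNReal

namespace PoissonOrlicz

noncomputable section

/-- The function `A(t) = t^{n/2} log(e + t)^q`, for `t ≥ 0`. -/
def logBump (n : ℕ) (q : ℝ) (t : ℝ) : ℝ :=
  t ^ ((n : ℝ) / 2) * Real.log (Real.exp 1 + t) ^ q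

/-- The Luxemburg norm `inf {l > 0 : ∫ A(|h| / l) dμ ≤ 1}`, equal to `∞` if there is no
admissible `l`. -/
def luxemburgNorm {X : Type*} [MeasurableSpace X] (A : ℝ → ℝ) (h : X → ℝ) (μ : Measure X) :
    ℝ≥0∞ :=
  ⨅ (l : ℝ) (_ : 0 < l) (_ : ∫⁻ x, ENNReal.ofReal (A (|h x| / l)) ∂μ ≤ 1), ENNReal.ofReal l

/-- Membership in the Orlicz space `L^A(μ)`: (a.e.) measurable with finite Luxemburg norm. -/
def MemOrlicz {X : Type*} [MeasurableSpace X] (A : ℝ → ℝ) (h : X → ℝ) (μ : Measure X) : Prop :=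
  AEStronglyMeasurable h μ ∧ luxemburgNorm A h μ < ∞

/-- `ψ ∈ Lip_0(Ω)`: Lipschitz with compact support contained in `Ω` (extended by zero outside
`Ω`). -/
def IsLipZero {n : ℕ} (Ω : Set (EuclideanSpace ℝ (Fin n))) (ψ : EuclideanSpace ℝ (Fin n) → ℝ) :
    Prop :=
  (∃ K : ℝ≥0, LipschitzWith K ψ) ∧ HasCompactSupport ψ ∧ tsupport ψ ⊆ Ω

/-- `(u, g) ∈ H^1_0(Ω)`, where `g` is the gradient of `u`: the pair is the limit in
`L^2(Ω) × L^2(Ω; ℝⁿ)` of pairs `(ψ_j, ∇ψ_j)` with `ψ_j ∈ Lip_0(Ω)`. (Such `ψ_j` are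
differentiable almost everywhere by Rademacher's theorem.) -/
def MemHOneZero {n : ℕ} (Ω : Set (EuclideanSpace ℝ (Fin n)))
    (u : EuclideanSpace ℝ (Fin n) → ℝ)
    (g : EuclideanSpace ℝ (Fin n) → EuclideanSpace ℝ (Fin n)) : Prop :=
  MemLp u 2 (volume.restrict Ω) ∧ MemLp g 2 (volume.restrict Ω) ∧
    ∃ ψ : ℕ → EuclideanSpace ℝ (Fin n) → ℝ, (∀ j, IsLipZero Ω (ψ j)) ∧
      Tendsto (fun j => eLpNorm (fun x => ψ j x - u x) 2 (volume.restrict Ω)) atTop (𝓝 0) ∧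
      Tendsto (fun j => eLpNorm (fun x => gradient (ψ j) x - g x) 2 (volume.restrict Ω))
        atTop (𝓝 0)

/-- `(u, g)`, with `g = ∇u`, is a weak solution of `-Δu = f` in `Ω`, `u = 0` on `∂Ω`:
it lies in `H^1_0(Ω)` and `∫_Ω ∇ψ · ∇u = ∫_Ω f ψ` for every `ψ ∈ Lip_0(Ω)`. -/
def IsWeakSolution {n : ℕ} (Ω : Set (EuclideanSpace ℝ (Fin n)))
    (f : EuclideanSpace ℝ (Fin n) → ℝ) (u : EuclideanSpace ℝ (Fin n) → ℝ)
    (g : EuclideanSpace ℝ (Fin n) → EuclideanSpace ℝ (Fin n)) : Prop :=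
  MemHOneZero Ω u g ∧
    ∀ ψ : EuclideanSpace ℝ (Fin n) → ℝ, IsLipZero Ω ψ →
      IntegrableOn (fun x => f x * ψ x) Ω ∧
        ∫ x in Ω, inner ℝ (gradient ψ x) (g x) = ∫ x in Ω, f x * ψ x

/-- A weak solution that is non-negative almost everywhere in `Ω`. -/
def IsNonnegWeakSolution {n : ℕ} (Ω : Set (EuclideanSpace ℝ (Fin n)))
    (f : EuclideanSpace ℝ (Fin n) → ℝ) (u : EuclideanSpace ℝ (Fin n) → ℝ)
    (g : EuclideanSpace ℝ (Fin n) → EuclideanSpace ℝ (Fin n)) : Prop :=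
  IsWeakSolution Ω f u g ∧ ∀ᵐ x ∂(volume.restrict Ω), 0 ≤ u x

/-- The function `|x|^{-2} log(e + |x|^{-1})^{-1}` (its value at the origin is irrelevant). -/
def witness (n : ℕ) (x : EuclideanSpace ℝ (Fin n)) : ℝ :=
  (‖x‖ ^ 2)⁻¹ * (Real.log (Real.exp 1 + ‖x‖⁻¹))⁻¹

end

end PoissonOrlicz

/-! ### Gradients of Lipschitz functions and Poincaré's inequality. -/

section LipschitzGradient

variable {E : Type*} [NormedAddCommGroup E] [InnerProductSpace ℝ E] [FiniteDimensional ℝ E]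

/-! The radial equation is -(r^{n-1} u')' = r^{n-1} f. Integrating it from 0 and substituting s =
r/t gives -u'(r) = W(r)/r, where W(r) = ∫_1^∞ t^{-(n-1)} / log(e + t/r) dt is `profile`. Since n ≥
3, 0 ≤ W ≤ 1; also W(r) ≥ 2^{-n} / log(e + 1/r). Hence u, normalised by u(1) = 0, is at least 2^{-n}
log log(e + 1/r) up to a constant and is unbounded at the origin (`tendsto_radialSol_atTop`). On the
other hand A(f) is at most of order |x|^{-n} log(e + 1/|x|)^{-(n/2 - max(q, 0))}, which is
integrable because that log exponent is below -1 (`memOrlicz_witness`).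

The weak formulation needs no divergence theorem. Integrating along rays, ψ(x) = -∫_1^∞ ∇ψ(tx)·x dt;
multiplying by f(x), integrating in x and substituting y = tx inside the t-integral turns ∫ f ψ into
∫ ∇ψ·∇u, with exactly the profile W appearing
(`IsLipZero.integral_inner_gradient_solutionGradient`).

Membership in H^1_0 comes from truncating u near the origin and near the boundary: u, ∇u and all the
errors are dominated by 1/|x|, which is in L^2(B) as n ≥ 3. For uniqueness, the difference of two
gradients is an L^2 limit of test gradients to which it is orthogonal, so it vanishes; Poincaré's
inequality then makes the functions agree. A finite C would bound ‖u‖_∞ = ∞ by C‖f‖ < ∞. -/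

theorem norm_gradient_eq_norm_fderiv (f : E → ℝ) (x : E) : ‖gradient f x‖ = ‖fderiv ℝ f x‖ := by
  rw [← toDual_gradient (𝕜 := ℝ), LinearIsometryEquiv.norm_map]

theorem LipschitzWith.norm_gradient_le {K : ℝ≥0} {f : E → ℝ} (hf : LipschitzWith K f) (x : E) :
    ‖gradient f x‖ ≤ K := by
  rw [norm_gradient_eq_norm_fderiv]
  exact norm_fderiv_le_of_lipschitz ℝ hf

theorem gradient_eq_zero_of_notMem_tsupport {f : E → ℝ} {x : E} (hx : x ∉ tsupport f) :
    gradient f x = 0 := by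
  rw [← norm_eq_zero, norm_gradient_eq_norm_fderiv, fderiv_of_notMem_tsupport ℝ hx, norm_zero]

variable [MeasurableSpace E] [BorelSpace E]

theorem measurable_gradient (f : E → ℝ) : Measurable (gradient f) := by
  unfold gradient
  exact (LinearIsometryEquiv.continuous _).measurable.comp (measurable_fderiv ℝ f)

/-- Poincaré's inequality for compactly supported Lipschitz functions that vanish outside the unit
ball, in integral form. -/
theorem LipschitzWith.integral_sq_le_four_mul_integral_norm_gradient_sq [Nontrivial E] {K : ℝ≥0}
    {f : E → ℝ} (hf : LipschitzWith K f) (hc : HasCompactSupport f)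
    (hs : tsupport f ⊆ Metric.ball 0 1) :
    ∫ x, f x ^ 2 ≤ 4 * ∫ x, ‖gradient f x‖ ^ 2 := by
  obtain ⟨v, hv⟩ := exists_norm_eq E zero_le_one
  obtain ⟨M, hM⟩ := hc.exists_bound_of_continuous hf.continuous
  have hM0 : 0 ≤ M := (norm_nonneg _).trans (hM 0)
  -- The square of a Lipschitz function is Lipschitz here because f is bounded by M. The proof
  -- integrates f² by parts against the linear function ⟨v, x⟩, whose derivative along the unit
  -- vector v is 1: ∫ f² = -∫ 2 f ∂_v f ⟨v, x⟩.
  have hf2 : LipschitzWith (2 * M.toNNReal * K) (fun x => f x * f x) := by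
    refine LipschitzWith.of_dist_le_mul fun x y => ?_
    have h1 := hf.dist_le_mul x y
    have hx := hM x
    have hy := hM y
    rw [Real.dist_eq] at h1 ⊢
    rw [show f x * f x - f y * f y = (f x + f y) * (f x - f y) by ring, abs_mul]
    push_cast
    rw [Real.coe_toNNReal M hM0]
    have h2 : |f x + f y| ≤ 2 * M := by
      rw [Real.norm_eq_abs] at hx hy
      linarith [abs_add_le (f x) (f y)]
    calc _ ≤ (2 * M) * (K * dist x y) := by gcongr
      _ = _ := by ring
  have hc2 : HasCompactSupport (fun x => f x * f x) := hc.mul_left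
  have hl : LipschitzWith ‖innerSL ℝ v‖₊ (innerSL ℝ v) := (innerSL ℝ v).lipschitz
  have key := hl.integral_lineDeriv_mul_eq (μ := volume) hf2 hc2 v
  have h1 : ∀ x, lineDeriv ℝ (innerSL ℝ v) x v = 1 := by
    intro x
    rw [((innerSL ℝ v).differentiableAt).lineDeriv_eq_fderiv, ContinuousLinearMap.fderiv]
    simp [hv]
  simp only [h1, one_mul] at key
  have hint : Integrable (fun x => f x ^ 2) :=
    Continuous.integrable_of_hasCompactSupport (by have := hf.continuous; fun_prop)
      (by simpa [pow_two] using hc2)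
  have hfin : Integrable (fun x => ‖gradient f x‖ ^ 2) := by
    have : IntegrableOn (fun x => ‖gradient f x‖ ^ 2) (tsupport f) := by
      refine Measure.integrableOn_of_bounded (M := (K : ℝ) ^ 2) hc.measure_lt_top.ne
        ((measurable_gradient f).norm.pow_const 2).aestronglyMeasurable ?_
      filter_upwards with x
      rw [Real.norm_of_nonneg (by positivity)]
      gcongr
      exact hf.norm_gradient_le x
    rwa [integrableOn_iff_integrable_of_support_subset] at this
    intro x hx
    by_contra hx'
    simp [gradient_eq_zero_of_notMem_tsupport hx'] at hx
  have hle : ∫ x, lineDeriv ℝ (fun x => f x * f x) x (-v) * innerSL ℝ v x ≤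
      ∫ x, (2⁻¹ * f x ^ 2 + 2 * ‖gradient f x‖ ^ 2) := by
    -- In the non-integrable case the integral is 0 by convention, and the right-hand side is
    -- non-negative.
    by_cases hi : Integrable fun x => lineDeriv ℝ (fun x => f x * f x) x (-v) * innerSL ℝ v x
    swap
    · rw [integral_undef hi]
      exact integral_nonneg fun x => by positivity
    refine integral_mono_ae hi ((hint.const_mul _).add (hfin.const_mul _)) ?_
    filter_upwards [hf.ae_differentiableAt] with x hx
    have h3 : lineDeriv ℝ (fun x => f x * f x) x (-v) = -(2 * f x * fderiv ℝ f x v) := by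
      rw [(hx.fun_mul hx).lineDeriv_eq_fderiv, fderiv_fun_mul hx hx]
      simp
      ring
    rw [h3]
    by_cases hxs : x ∈ tsupport f
    swap
    · rw [image_eq_zero_of_notMem_tsupport hxs]
      simp
    have hx1 : ‖x‖ ≤ 1 := (mem_ball_zero_iff.1 (hs hxs)).le
    have h4 : |fderiv ℝ f x v| ≤ ‖gradient f x‖ := by
      rw [norm_gradient_eq_norm_fderiv, ← Real.norm_eq_abs]
      simpa [hv] using (fderiv ℝ f x).le_opNorm v
    have h5 : |innerSL ℝ v x| ≤ 1 := by
      have := abs_real_inner_le_norm v x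
      rw [hv, one_mul] at this
      simpa using this.trans hx1
    calc -(2 * f x * fderiv ℝ f x v) * innerSL ℝ v x
        ≤ |-(2 * f x * fderiv ℝ f x v) * innerSL ℝ v x| := le_abs_self _
      _ = 2 * |f x| * |fderiv ℝ f x v| * |innerSL ℝ v x| := by simp [abs_mul]
      _ ≤ 2 * |f x| * ‖gradient f x‖ * 1 := by gcongr
      -- The weights of Young's inequality are chosen so that half of ∫ f² can be absorbed, leaving
      -- the constant 4.
      _ ≤ 2⁻¹ * f x ^ 2 + 2 * ‖gradient f x‖ ^ 2 := by
        rw [← sq_abs (f x)]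
        nlinarith [sq_nonneg (|f x| - 2 * ‖gradient f x‖)]
  rw [← key, integral_add (hint.const_mul _) (hfin.const_mul _), integral_const_mul,
    integral_const_mul] at hle
  simp only [← pow_two] at hle
  linarith

end LipschitzGradient

/-! ### Uniqueness of weak solutions. -/

namespace PoissonOrlicz

variable {n : ℕ} {Ω : Set (EuclideanSpace ℝ (Fin n))}

theorem IsLipZero.sub {φ ψ : EuclideanSpace ℝ (Fin n) → ℝ} (hφ : IsLipZero Ω φ)
    (hψ : IsLipZero Ω ψ) : IsLipZero Ω (φ - ψ) := by
  obtain ⟨⟨K, hK⟩, hc, hs⟩ := hφ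
  obtain ⟨⟨K', hK'⟩, hc', hs'⟩ := hψ
  exact ⟨⟨K + K', hK.sub hK'⟩, hc.sub hc', (tsupport_sub _ _).trans (Set.union_subset hs hs')⟩

theorem IsLipZero.ae_gradient_sub {φ ψ : EuclideanSpace ℝ (Fin n) → ℝ} (hφ : IsLipZero Ω φ)
    (hψ : IsLipZero Ω ψ) : gradient (φ - ψ) =ᵐ[volume] gradient φ - gradient ψ := by
  obtain ⟨⟨K, hK⟩, -⟩ := hφ
  obtain ⟨⟨K', hK'⟩, -⟩ := hψ
  filter_upwards [hK.ae_differentiableAt, hK'.ae_differentiableAt] with x hx hx'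
  simp [gradient, fderiv_sub hx hx']

theorem IsLipZero.memLp {ψ : EuclideanSpace ℝ (Fin n) → ℝ} (hψ : IsLipZero Ω ψ) (p : ℝ≥0∞) :
    MemLp ψ p volume := by
  obtain ⟨⟨K, hK⟩, hc, hs⟩ := hψ
  exact hK.continuous.memLp_of_hasCompactSupport hc

theorem IsLipZero.memLp_gradient {ψ : EuclideanSpace ℝ (Fin n) → ℝ} (hψ : IsLipZero Ω ψ)
    (p : ℝ≥0∞) : MemLp (gradient ψ) p volume := by
  obtain ⟨⟨K, hK⟩, hc, hs⟩ := hψ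
  have hm := hc.isCompact.measurableSet
  rw [show gradient ψ = (tsupport ψ).indicator (gradient ψ) from
    (Set.indicator_eq_self.2 fun x hx => by
      by_contra hx'
      exact hx (gradient_eq_zero_of_notMem_tsupport hx')).symm, memLp_indicator_iff_restrict hm]
  have : IsFiniteMeasure (volume.restrict (tsupport ψ)) :=
    isFiniteMeasure_restrict.2 hc.measure_lt_top.ne
  exact MemLp.of_bound (measurable_gradient ψ).aestronglyMeasurable K
    (ae_of_all _ hK.norm_gradient_le)

theorem IsLipZero.eLpNorm_le_two_mul_eLpNorm_gradient [NeZero n]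
    {ψ : EuclideanSpace ℝ (Fin n) → ℝ} (hψ : IsLipZero (Metric.ball 0 1) ψ) :
    eLpNorm ψ 2 (volume.restrict (Metric.ball 0 1)) ≤
      2 * eLpNorm (gradient ψ) 2 (volume.restrict (Metric.ball 0 1)) := by
  have h1 := hψ.memLp 2
  have h2 := hψ.memLp_gradient 2
  obtain ⟨⟨K, hK⟩, hc, hs⟩ := hψ
  have key := hK.integral_sq_le_four_mul_integral_norm_gradient_sq hc hs
  rw [(h1.restrict _).eLpNorm_eq_integral_rpow_norm (by simp) (by simp),
    (h2.restrict _).eLpNorm_eq_integral_rpow_norm (by simp) (by simp)]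
  suffices h : (∫ x in Metric.ball 0 1, ‖ψ x‖ ^ (2 : ℝ≥0∞).toReal) ^ ((2 : ℝ≥0∞).toReal)⁻¹ ≤
      2 * (∫ x in Metric.ball 0 1, ‖gradient ψ x‖ ^ (2 : ℝ≥0∞).toReal) ^
        ((2 : ℝ≥0∞).toReal)⁻¹ by
    refine (ENNReal.ofReal_le_ofReal h).trans_eq ?_
    rw [ENNReal.ofReal_mul zero_le_two]
    congr 1
    exact ENNReal.ofReal_ofNat 2
  rw [setIntegral_eq_integral_of_forall_compl_eq_zero,
    setIntegral_eq_integral_of_forall_compl_eq_zero]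
  · simp only [ENNReal.toReal_ofNat, Real.rpow_two, Real.norm_eq_abs, sq_abs]
    rw [← one_div, ← Real.sqrt_eq_rpow, ← Real.sqrt_eq_rpow]
    rw [Real.sqrt_le_left (by positivity), mul_pow, Real.sq_sqrt (by positivity)]
    linarith
  · intro x hx
    simp [gradient_eq_zero_of_notMem_tsupport fun h => hx (hs h)]
  · intro x hx
    simp [image_eq_zero_of_notMem_tsupport fun h => hx (hs h)]

/-- Passing to the limit in ⟨c_j, k⟩ = 0 gives ⟨k, k⟩ = 0 in L². -/
theorem ae_eq_zero_of_tendsto_of_inner_eq_zero {X F : Type*} [MeasurableSpace X] {μ : Measure X}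
    [NormedAddCommGroup F] [InnerProductSpace ℝ F] {k : X → F} (hk : MemLp k 2 μ) {c : ℕ → X → F}
    (hc : ∀ j, MemLp (c j) 2 μ) (hlim : Tendsto (fun j => eLpNorm (c j - k) 2 μ) atTop (𝓝 0))
    (h0 : ∀ j, ∫ x, inner ℝ (c j x) (k x) ∂μ = 0) : k =ᵐ[μ] 0 := by
  have h1 := (Lp.tendsto_Lp_iff_tendsto_eLpNorm'' c hc k hk).2 hlim
  have h2 : ∀ j, inner ℝ ((hc j).toLp (c j)) (hk.toLp k) = 0 := by
    intro j
    rw [L2.inner_def, ← h0 j]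
    apply integral_congr_ae
    filter_upwards [(hc j).coeFn_toLp, hk.coeFn_toLp] with x hx hx'
    rw [hx, hx']
  have h3 : inner ℝ (hk.toLp k) (hk.toLp k) = 0 :=
    tendsto_nhds_unique (h1.inner tendsto_const_nhds) (by simp [h2])
  rw [inner_self_eq_zero, Lp.eq_zero_iff_ae_eq_zero] at h3
  exact hk.coeFn_toLp.symm.trans h3

theorem integrable_inner_of_memLp_two {X F : Type*} [MeasurableSpace X] {μ : Measure X}
    [NormedAddCommGroup F] [InnerProductSpace ℝ F] {f g : X → F} (hf : MemLp f 2 μ)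
    (hg : MemLp g 2 μ) : Integrable (fun x => inner ℝ (f x) (g x)) μ := by
  refine (L2.integrable_inner (𝕜 := ℝ) (hf.toLp f) (hg.toLp g)).congr ?_
  filter_upwards [hf.coeFn_toLp, hg.coeFn_toLp] with x hx hx'
  rw [hx, hx']

/-- The sequence d is only a.e. equal to a - b because it is applied to ∇(a_j - b_j), which splits
only where both functions are differentiable. -/
theorem tendsto_eLpNorm_sub_sub {X F : Type*} [MeasurableSpace X] {μ : Measure X}
    [NormedAddCommGroup F] {a b : ℕ → X → F} {u v : X → F} {d : ℕ → X → F}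
    (hau : Tendsto (fun j => eLpNorm (fun x => a j x - u x) 2 μ) atTop (𝓝 0))
    (hbv : Tendsto (fun j => eLpNorm (fun x => b j x - v x) 2 μ) atTop (𝓝 0))
    (ha : ∀ j, AEStronglyMeasurable (a j) μ) (hb : ∀ j, AEStronglyMeasurable (b j) μ)
    (hu : AEStronglyMeasurable u μ) (hv : AEStronglyMeasurable v μ)
    (hd : ∀ j, d j =ᵐ[μ] a j - b j) :
    Tendsto (fun j => eLpNorm (d j - (u - v)) 2 μ) atTop (𝓝 0) := by
  refine tendsto_of_tendsto_of_tendsto_of_le_of_le tendsto_const_nhds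
    (by simpa using hau.add hbv) (fun _ => zero_le) fun j => ?_
  calc eLpNorm (d j - (u - v)) 2 μ
      = eLpNorm ((fun x => a j x - u x) - (fun x => b j x - v x)) 2 μ := by
        apply eLpNorm_congr_ae
        filter_upwards [hd j] with x hx
        simp only [Pi.sub_apply, hx]
        abel
    _ ≤ _ := eLpNorm_sub_le ((ha j).sub hu) ((hb j).sub hv) (by norm_num)

/-- Weak solutions of the Dirichlet problem in the unit ball are unique. -/
theorem IsWeakSolution.unique [NeZero n] {f u w : EuclideanSpace ℝ (Fin n) → ℝ}
    {g h : EuclideanSpace ℝ (Fin n) → EuclideanSpace ℝ (Fin n)}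
    (hw : IsWeakSolution (Metric.ball 0 1) f w h) (hu : IsWeakSolution (Metric.ball 0 1) f u g) :
    w =ᵐ[volume.restrict (Metric.ball 0 1)] u ∧ h =ᵐ[volume.restrict (Metric.ball 0 1)] g := by
  set μ := (volume : Measure (EuclideanSpace ℝ (Fin n))).restrict (Metric.ball 0 1) with hμ
  obtain ⟨⟨hw2, hh2, a, ha, haw, hah⟩, hwf⟩ := hw
  obtain ⟨⟨hu2, hg2, b, hb, hbu, hbg⟩, huf⟩ := hu
  have hab j : IsLipZero (Metric.ball 0 1) (a j - b j) := (ha j).sub (hb j)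
  have T1 : Tendsto (fun j => eLpNorm ((a j - b j) - (w - u)) 2 μ) atTop (𝓝 0) :=
    tendsto_eLpNorm_sub_sub haw hbu (fun j => ((ha j).memLp 2).1.restrict)
      (fun j => ((hb j).memLp 2).1.restrict) hw2.1 hu2.1 fun j => ae_eq_rfl
  have T2 : Tendsto (fun j => eLpNorm (gradient (a j - b j) - (h - g)) 2 μ) atTop (𝓝 0) :=
    tendsto_eLpNorm_sub_sub hah hbg (fun j => ((ha j).memLp_gradient 2).1.restrict)
      (fun j => ((hb j).memLp_gradient 2).1.restrict) hh2.1 hg2.1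
      fun j => ae_restrict_of_ae ((ha j).ae_gradient_sub (hb j))
  have hgrad : h - g =ᵐ[μ] 0 := by
    refine ae_eq_zero_of_tendsto_of_inner_eq_zero (hh2.sub hg2)
      (fun j => ((hab j).memLp_gradient 2).restrict _) T2 fun j => ?_
    have G := ((hab j).memLp_gradient 2).restrict (Metric.ball 0 1)
    simp only [Pi.sub_apply, inner_sub_right]
    rw [integral_sub (integrable_inner_of_memLp_two G hh2) (integrable_inner_of_memLp_two G hg2),
      (hwf _ (hab j)).2, (huf _ (hab j)).2, sub_self]
  have hval : w - u =ᵐ[μ] 0 := by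
    -- As h = g, the gradients of a_j - b_j themselves tend to 0; Poincaré then sends a_j - b_j to
    -- 0, while it also tends to w - u.
    have T3 : Tendsto (fun j => eLpNorm (gradient (a j - b j)) 2 μ) atTop (𝓝 0) := by
      refine T2.congr fun j => eLpNorm_congr_ae ?_
      filter_upwards [hgrad] with x hx
      rw [Pi.sub_apply, hx, Pi.zero_apply, sub_zero]
    have T4 : Tendsto (fun j => eLpNorm ((a j - b j) - (w - u)) 2 μ +
        2 * eLpNorm (gradient (a j - b j)) 2 μ) atTop (𝓝 0) := by
      simpa using T1.add (ENNReal.Tendsto.const_mul T3 (Or.inr (by simp)))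
    have : eLpNorm (w - u) 2 μ ≤ 0 := by
      refine ge_of_tendsto' T4 fun j => ?_
      have P := (hab j).eLpNorm_le_two_mul_eLpNorm_gradient
      calc eLpNorm (w - u) 2 μ = eLpNorm ((a j - b j) - ((a j - b j) - (w - u))) 2 μ := by
            rw [sub_sub_cancel]
        _ ≤ eLpNorm (a j - b j) 2 μ + eLpNorm ((a j - b j) - (w - u)) 2 μ :=
            eLpNorm_sub_le ((hab j).memLp 2).1.restrict
              (((hab j).memLp 2).1.restrict.sub (hw2.1.sub hu2.1)) (by norm_num)
        _ ≤ _ := by rw [add_comm]; gcongr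
    rwa [nonpos_iff_eq_zero, eLpNorm_eq_zero_iff (hw2.1.sub hu2.1) (by simp)] at this
  exact ⟨(sub_ae_eq_zero _ _).1 hval, (sub_ae_eq_zero _ _).1 hgrad⟩

end PoissonOrlicz

/-! ### The radial profile and the radial solution. -/

namespace PoissonOrlicz

noncomputable section

/-- The radial profile `W` such that `∇u(x) = -W(|x|) |x|⁻² x`. -/
def profile (n : ℕ) (r : ℝ) : ℝ :=
  ∫ t in Set.Ioi (1 : ℝ), (t ^ (n - 1))⁻¹ * (Real.log (Real.exp 1 + t / r))⁻¹

/-- The radial solution, as a function of `r = |x|`. -/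
def radialSol (n : ℕ) (r : ℝ) : ℝ := ∫ s in r..1, profile n s / s

end

theorem one_le_log_exp_one_add {t : ℝ} (ht : 0 ≤ t) : 1 ≤ Real.log (Real.exp 1 + t) := by
  rw [Real.le_log_iff_exp_le (by positivity)]
  linarith

theorem inv_log_exp_one_add_le_one {t : ℝ} (ht : 0 ≤ t) :
    (Real.log (Real.exp 1 + t))⁻¹ ≤ 1 :=
  inv_le_one_of_one_le₀ (one_le_log_exp_one_add ht)

theorem integrableOn_Ioi_inv_sq : IntegrableOn (fun t : ℝ => (t ^ 2)⁻¹) (Set.Ioi 1) := by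
  refine (integrableOn_Ioi_rpow_of_lt (a := -2) (by norm_num) one_pos).congr_fun
    (fun t ht => ?_) measurableSet_Ioi
  simp [Real.rpow_neg (zero_le_one.trans (Set.mem_Ioi.1 ht).le)]

theorem integral_Ioi_inv_sq : ∫ t in Set.Ioi (1 : ℝ), (t ^ 2)⁻¹ = 1 := by
  have h := integral_Ioi_rpow_of_lt (a := -2) (by norm_num) one_pos
  norm_num at h
  refine Eq.trans ?_ h
  refine setIntegral_congr_fun measurableSet_Ioi fun t _ => ?_
  simp

theorem inv_pow_le_inv_sq {n : ℕ} (hn : 3 ≤ n) {t : ℝ} (ht : 1 < t) :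
    (t ^ (n - 1))⁻¹ ≤ (t ^ 2)⁻¹ := by
  gcongr
  · exact ht.le
  · omega

variable {n : ℕ}

theorem profile_integrand_nonneg {t r : ℝ} (ht : 1 < t) (hr : 0 ≤ r) :
    0 ≤ (t ^ (n - 1))⁻¹ * (Real.log (Real.exp 1 + t / r))⁻¹ := by
  have := one_le_log_exp_one_add (t := t / r) (by positivity)
  positivity

theorem profile_integrand_le (hn : 3 ≤ n) {t r : ℝ} (ht : 1 < t) (hr : 0 ≤ r) :
    (t ^ (n - 1))⁻¹ * (Real.log (Real.exp 1 + t / r))⁻¹ ≤ (t ^ 2)⁻¹ := by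
  rw [← mul_one (t ^ 2)⁻¹]
  have := one_le_log_exp_one_add (t := t / r) (by positivity)
  exact mul_le_mul (inv_pow_le_inv_sq hn ht) (inv_log_exp_one_add_le_one (by positivity))
    (by positivity) (by positivity)

theorem integrableOn_profile_integrand (hn : 3 ≤ n) {r : ℝ} (hr : 0 ≤ r) :
    IntegrableOn (fun t => (t ^ (n - 1))⁻¹ * (Real.log (Real.exp 1 + t / r))⁻¹) (Set.Ioi 1) := by
  refine Integrable.mono' integrableOn_Ioi_inv_sq (Measurable.aestronglyMeasurable (by fun_prop)) ?_
  filter_upwards [ae_restrict_mem measurableSet_Ioi] with t ht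
  rw [Real.norm_of_nonneg (profile_integrand_nonneg ht hr)]
  exact profile_integrand_le hn ht hr

theorem profile_nonneg {r : ℝ} (hr : 0 ≤ r) : 0 ≤ profile n r :=
  setIntegral_nonneg measurableSet_Ioi fun _ ht => profile_integrand_nonneg ht hr

theorem profile_le_one (hn : 3 ≤ n) {r : ℝ} (hr : 0 ≤ r) : profile n r ≤ 1 := by
  rw [← integral_Ioi_inv_sq]
  exact setIntegral_mono_on (integrableOn_profile_integrand hn hr) integrableOn_Ioi_inv_sq
    measurableSet_Ioi fun t ht => profile_integrand_le hn ht hr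

theorem log_exp_one_add_two_mul_le {s : ℝ} (hs : 0 ≤ s) :
    Real.log (Real.exp 1 + 2 * s) ≤ 2 * Real.log (Real.exp 1 + s) := by
  have he := Real.exp_one_gt_d9
  rw [← Real.log_rpow (by positivity)]
  apply Real.log_le_log (by positivity)
  rw [Real.rpow_two]
  nlinarith [sq_nonneg s]

/-- Only t ∈ (1, 2] is kept: there t^{n-1} ≤ 2^{n-1} and log(e + t/r) ≤ log(e + 2/r) ≤ 2 log(e +
1/r). -/
theorem le_profile (hn : 3 ≤ n) {r : ℝ} (hr : 0 < r) :
    (2 ^ n)⁻¹ * (Real.log (Real.exp 1 + r⁻¹))⁻¹ ≤ profile n r := by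
  have h1 : ∫ t in Set.Ioc (1 : ℝ) 2, (2 ^ n)⁻¹ * (Real.log (Real.exp 1 + r⁻¹))⁻¹ =
      (2 ^ n)⁻¹ * (Real.log (Real.exp 1 + r⁻¹))⁻¹ := by
    simp
    norm_num
  have hI := integrableOn_profile_integrand hn hr.le
  rw [← h1]
  calc _ ≤ ∫ t in Set.Ioc (1 : ℝ) 2, (t ^ (n - 1))⁻¹ * (Real.log (Real.exp 1 + t / r))⁻¹ := by
        refine setIntegral_mono_on (integrableOn_const (by simp)) (hI.mono_set Set.Ioc_subset_Ioi_self)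
          measurableSet_Ioc fun t ht => ?_
        have h2 := log_exp_one_add_two_mul_le (s := r⁻¹) (by positivity)
        have h3 := one_le_log_exp_one_add (t := r⁻¹) (by positivity)
        have ht0 : 0 < t := one_pos.trans ht.1
        have h4 := one_le_log_exp_one_add (t := t / r) (by positivity)
        have h5 : Real.log (Real.exp 1 + t / r) ≤ 2 * Real.log (Real.exp 1 + r⁻¹) := by
          refine le_trans (Real.log_le_log (by positivity) ?_) h2
          rw [div_eq_mul_inv]
          gcongr
          exact ht.2
        have h6 : t ^ (n - 1) ≤ 2 ^ (n - 1) := by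
          have := ht.2
          gcongr
        have h7 : (2 : ℝ) ^ n = 2 ^ (n - 1) * 2 := by
          rw [← pow_succ]
          congr 1
          omega
        rw [← mul_inv, ← mul_inv]
        apply inv_anti₀ (by positivity)
        rw [h7, mul_assoc]
        gcongr
    _ ≤ _ := by
        refine setIntegral_mono_set hI ?_ (ae_of_all _ Set.Ioc_subset_Ioi_self)
        filter_upwards [ae_restrict_mem measurableSet_Ioi] with t ht
        exact profile_integrand_nonneg ht hr.le

theorem continuousOn_profile (hn : 3 ≤ n) : ContinuousOn (profile n) (Set.Ioi 0) := by
  refine continuousOn_of_dominated (bound := fun t => (t ^ 2)⁻¹)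
    (fun r _ => Measurable.aestronglyMeasurable (by fun_prop)) (fun r hr => ?_)
    integrableOn_Ioi_inv_sq ?_
  · filter_upwards [ae_restrict_mem measurableSet_Ioi] with t ht
    rw [Real.norm_of_nonneg (profile_integrand_nonneg ht (le_of_lt hr))]
    exact profile_integrand_le hn ht (le_of_lt hr)
  · filter_upwards [ae_restrict_mem measurableSet_Ioi] with t ht r hr
    have ht0 : 0 < t := one_pos.trans ht
    have hr0 : 0 < r := hr
    have := one_le_log_exp_one_add (t := t / r) (by positivity)
    have h2 : Real.exp 1 + t / r ≠ 0 := by positivity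
    have h3 : Real.log (Real.exp 1 + t / r) ≠ 0 := by positivity
    apply ContinuousAt.continuousWithinAt
    have h4 := hr0.ne'
    fun_prop (disch := assumption)

theorem continuousOn_profile_div (hn : 3 ≤ n) :
    ContinuousOn (fun s => profile n s / s) (Set.Ioi 0) :=
  (continuousOn_profile hn).div continuousOn_id fun _ hs => ne_of_gt hs

theorem intervalIntegrable_profile_div (hn : 3 ≤ n) {a b : ℝ} (ha : 0 < a) (hb : 0 < b) :
    IntervalIntegrable (fun s => profile n s / s) volume a b :=
  ((continuousOn_profile_div hn).mono fun s hs => by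
    rcases Set.mem_uIcc.1 hs with h | h
    · exact ha.trans_le h.1
    · exact hb.trans_le h.1).intervalIntegrable

theorem hasDerivAt_radialSol (hn : 3 ≤ n) {r : ℝ} (hr : 0 < r) :
    HasDerivAt (radialSol n) (-(profile n r / r)) r :=
  intervalIntegral.integral_hasDerivAt_left (intervalIntegrable_profile_div hn hr one_pos)
    ((continuousOn_profile_div hn).stronglyMeasurableAtFilter isOpen_Ioi _ hr)
    ((continuousOn_profile_div hn).continuousAt (Ioi_mem_nhds hr))

theorem radialSol_nonneg {r : ℝ} (hr : 0 ≤ r) (hr1 : r ≤ 1) : 0 ≤ radialSol n r :=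
  intervalIntegral.integral_nonneg hr1 fun _ hs =>
    div_nonneg (profile_nonneg (hr.trans hs.1)) (hr.trans hs.1)

theorem radialSol_one : radialSol n 1 = 0 := by simp [radialSol]

theorem continuousOn_radialSol (hn : 3 ≤ n) : ContinuousOn (radialSol n) (Set.Ioi 0) :=
  fun _ hr => (hasDerivAt_radialSol hn hr).continuousAt.continuousWithinAt

theorem antitoneOn_radialSol (hn : 3 ≤ n) : AntitoneOn (radialSol n) (Set.Ioi 0) := by
  refine antitoneOn_of_deriv_nonpos (convex_Ioi 0) (continuousOn_radialSol hn) ?_ ?_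
  · rw [interior_Ioi]
    exact fun r hr => (hasDerivAt_radialSol hn hr).differentiableAt.differentiableWithinAt
  · rw [interior_Ioi]
    intro r hr
    rw [(hasDerivAt_radialSol hn hr).deriv, neg_nonpos]
    exact div_nonneg (profile_nonneg (le_of_lt hr)) (le_of_lt hr)

/-- W ≤ 1 gives the bound log(1/r). The cruder 1/r is used so that one function in L²(B) dominates
both u and ∇u. -/
theorem radialSol_le_inv (hn : 3 ≤ n) {r : ℝ} (hr : 0 < r) (hr1 : r ≤ 1) :
    radialSol n r ≤ r⁻¹ := by
  calc radialSol n r ≤ ∫ s in r..1, s⁻¹ := by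
        refine intervalIntegral.integral_mono_on hr1 (intervalIntegrable_profile_div hn hr one_pos)
          ?_ fun s hs => ?_
        · refine (continuousOn_inv₀.mono fun s hs => ?_).intervalIntegrable
          rw [Set.uIcc_of_le hr1] at hs
          exact (hr.trans_le hs.1).ne'
        · have hs0 := hr.trans_le hs.1
          rw [div_eq_mul_inv]
          exact mul_le_of_le_one_left (by positivity) (profile_le_one hn hs0.le)
    _ = Real.log r⁻¹ := by
        rw [integral_inv_of_pos hr one_pos, one_div]
    _ ≤ r⁻¹ := (Real.log_le_sub_one_of_pos (by positivity)).trans (by linarith)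

theorem hasDerivAt_log_exp_one_add_inv {r : ℝ} (hr : 0 < r) :
    HasDerivAt (fun r => Real.log (Real.exp 1 + r⁻¹))
      (-(r * (Real.exp 1 * r + 1))⁻¹) r := by
  have h1 : Real.exp 1 + r⁻¹ ≠ 0 := by positivity
  convert! ((hasDerivAt_inv hr.ne').const_add (Real.exp 1)).log h1 using 1
  field_simp

theorem tendsto_log_exp_one_add_inv :
    Tendsto (fun r : ℝ => Real.log (Real.exp 1 + r⁻¹)) (𝓝[>] 0) atTop :=
  Real.tendsto_log_atTop.comp (tendsto_atTop_add_const_left _ _ tendsto_inv_nhdsGT_zero)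

theorem tendsto_radialSol_atTop (hn : 3 ≤ n) : Tendsto (radialSol n) (𝓝[>] 0) atTop := by
  have hc : (0 : ℝ) < (2 ^ n)⁻¹ := by positivity
  have hd : ∀ r : ℝ, 0 < r → HasDerivAt
      (fun r => radialSol n r - (2 ^ n)⁻¹ * Real.log (Real.log (Real.exp 1 + r⁻¹)))
      (-(profile n r / r) - (2 ^ n)⁻¹ *
        (-(r * (Real.exp 1 * r + 1))⁻¹ / Real.log (Real.exp 1 + r⁻¹))) r := by
    intro r hr
    have := one_le_log_exp_one_add (t := r⁻¹) (by positivity)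
    exact (hasDerivAt_radialSol hn hr).sub
      (((hasDerivAt_log_exp_one_add_inv hr).log (by positivity)).const_mul _)
  -- Comparison with 2^{-n} log log(e + 1/r): by `le_profile`, u decreases at least as fast, so the
  -- difference at r < 1 is at least its value at 1.
  have hanti : AntitoneOn
      (fun r => radialSol n r - (2 ^ n)⁻¹ * Real.log (Real.log (Real.exp 1 + r⁻¹)))
      (Set.Ioi 0) := by
    refine antitoneOn_of_deriv_nonpos (convex_Ioi 0)
      (fun r hr => (hd r hr).continuousAt.continuousWithinAt) ?_ ?_
    · rw [interior_Ioi]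
      exact fun r hr => (hd r hr).differentiableAt.differentiableWithinAt
    · rw [interior_Ioi]
      intro r hr
      have hr0 : 0 < r := hr
      have hL := one_le_log_exp_one_add (t := r⁻¹) (by positivity)
      rw [(hd r hr).deriv]
      have h1 := le_profile hn hr0
      have h2 : (r * (Real.exp 1 * r + 1))⁻¹ ≤ r⁻¹ := by
        apply inv_anti₀ hr0
        have := Real.exp_pos 1
        nlinarith [mul_pos this (mul_pos hr0 hr0)]
      have h3 : (2 ^ n)⁻¹ * ((r * (Real.exp 1 * r + 1))⁻¹ / Real.log (Real.exp 1 + r⁻¹)) ≤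
          profile n r / r := by
        calc _ ≤ (2 ^ n)⁻¹ * (r⁻¹ / Real.log (Real.exp 1 + r⁻¹)) := by gcongr
          _ = ((2 ^ n)⁻¹ * (Real.log (Real.exp 1 + r⁻¹))⁻¹) * r⁻¹ := by ring
          _ ≤ profile n r * r⁻¹ := by gcongr
          _ = _ := by rw [div_eq_mul_inv]
      rw [neg_div]
      linarith
  have hT : Tendsto (fun r : ℝ => (2 ^ n)⁻¹ * Real.log (Real.log (Real.exp 1 + r⁻¹)) +
      (radialSol n 1 - (2 ^ n)⁻¹ * Real.log (Real.log (Real.exp 1 + (1 : ℝ)⁻¹)))) (𝓝[>] 0)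
      atTop :=
    tendsto_atTop_add_const_right _ _
      ((Real.tendsto_log_atTop.comp tendsto_log_exp_one_add_inv).const_mul_atTop hc)
  refine tendsto_atTop_mono' _ ?_ hT
  filter_upwards [Ioo_mem_nhdsGT (zero_lt_one' ℝ)] with r hr
  have := hanti (Set.mem_Ioi.2 hr.1) (Set.mem_Ioi.2 one_pos) hr.2.le
  simp only at this
  linarith

end PoissonOrlicz

/-! ### The fundamental theorem of calculus along rays. -/

section RadialFundamentalTheorem

variable {E : Type*} [NormedAddCommGroup E] [InnerProductSpace ℝ E] [FiniteDimensional ℝ E]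
  [MeasurableSpace E] [BorelSpace E]

/-- For each fixed t the dilation by t pulls the null set of Rademacher's theorem back to a null
set; Fubini exchanges the quantifiers. -/
theorem LipschitzWith.ae_ae_differentiableAt_smul {K : ℝ≥0} {f : E → ℝ} (hf : LipschitzWith K f) :
    ∀ᵐ x : E, ∀ᵐ t ∂(volume.restrict (Set.Ioi (1 : ℝ))), DifferentiableAt ℝ f (t • x) := by
  rw [Measure.ae_ae_comm]
  · filter_upwards [ae_restrict_mem measurableSet_Ioi] with t ht
    have ht0 : t ≠ 0 := (one_pos.trans ht).ne'
    have h := hf.ae_differentiableAt (μ := volume)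
    rw [ae_iff] at h ⊢
    have := Measure.addHaar_preimage_smul volume ht0 {x | ¬DifferentiableAt ℝ f x}
    rwa [h, mul_zero] at this
  · have : Measurable fun p : E × ℝ => p.2 • p.1 := by fun_prop
    exact this (measurableSet_of_differentiableAt ℝ f)

theorem LipschitzWith.ae_integral_Ioi_inner_gradient_smul [Nontrivial E] {K : ℝ≥0} {f : E → ℝ}
    (hf : LipschitzWith K f) (hs : tsupport f ⊆ Metric.ball 0 1) :
    ∀ᵐ x : E, ∫ t in Set.Ioi (1 : ℝ), inner ℝ (gradient f (t • x)) x = -f x := by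
  filter_upwards [hf.ae_ae_differentiableAt_smul, compl_mem_ae_iff.2 (measure_singleton (0 : E))]
    with x hx hx0
  have hxn : 0 < ‖x‖ := norm_pos_iff.2 hx0
  -- From the parameter T on, the ray t ↦ tx is outside the open unit ball, so f and its gradient
  -- vanish there.
  set T := max 1 ‖x‖⁻¹ with hT
  have h1T : 1 ≤ T := le_max_left _ _
  have hout : ∀ t, T ≤ t → t • x ∉ tsupport f := by
    intro t ht hmem
    have h1 := mem_ball_zero_iff.1 (hs hmem)
    have h2 : ‖x‖⁻¹ ≤ t := (le_max_right _ _).trans ht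
    rw [norm_smul, Real.norm_of_nonneg (zero_le_one.trans (h1T.trans ht))] at h1
    have h3 : ‖x‖⁻¹ * ‖x‖ ≤ t * ‖x‖ := by gcongr
    rw [inv_mul_cancel₀ hxn.ne'] at h3
    linarith
  have hφ : LipschitzWith (K * ‖x‖₊) fun t : ℝ => f (t • x) := by
    refine LipschitzWith.of_dist_le_mul fun s t => (hf.dist_le_mul _ _).trans_eq ?_
    rw [dist_eq_norm, ← sub_smul, norm_smul, dist_eq_norm]
    push_cast
    ring
  have hac := (hφ.lipschitzOnWith (s := Set.uIcc 1 T)).absolutelyContinuousOnInterval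
  have key := hac.integral_deriv_eq_sub
  rw [image_eq_zero_of_notMem_tsupport (hout T le_rfl), one_smul, zero_sub] at key
  rw [← key, intervalIntegral.integral_of_le h1T]
  rw [setIntegral_eq_of_subset_of_forall_sdiff_eq_zero measurableSet_Ioi
    (Set.Ioc_subset_Ioi_self : Set.Ioc 1 T ⊆ Set.Ioi 1)]
  · refine integral_congr_ae ?_
    filter_upwards [ae_restrict_of_ae_restrict_of_subset
      (Set.Ioc_subset_Ioi_self : Set.Ioc 1 T ⊆ Set.Ioi 1) hx] with t ht
    have h1 : HasDerivAt (fun t : ℝ => t • x) x t := by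
      simpa using (hasDerivAt_id t).smul_const x
    have h2 := ht.hasFDerivAt.comp_hasDerivAt t h1
    rw [inner_gradient_left]
    exact h2.deriv.symm
  · rintro t ⟨ht1, ht2⟩
    have : T ≤ t := by
      by_contra h
      exact ht2 ⟨ht1, (not_le.1 h).le⟩
    rw [gradient_eq_zero_of_notMem_tsupport (hout t this), inner_zero_left]

end RadialFundamentalTheorem

/-! ### The weak formulation by Fubini and scaling. -/

namespace PoissonOrlicz

noncomputable section

/-- The weak solution `u` with right-hand side `witness n`. -/
def solution (n : ℕ) (x : EuclideanSpace ℝ (Fin n)) : ℝ := radialSol n ‖x‖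

/-- The gradient of `solution n`. -/
def solutionGradient (n : ℕ) (x : EuclideanSpace ℝ (Fin n)) : EuclideanSpace ℝ (Fin n) :=
  -(profile n ‖x‖ / ‖x‖ ^ 2) • x

/-- The integrand of the Fubini argument behind the weak formulation, after rescaling. -/
def fluxIntegrand {n : ℕ} (ψ : EuclideanSpace ℝ (Fin n) → ℝ)
    (p : EuclideanSpace ℝ (Fin n) × ℝ) : ℝ :=
  ((‖p.1‖ ^ 2)⁻¹ * inner ℝ (gradient ψ p.1) p.1) *
    ((p.2 ^ (n - 1))⁻¹ * (Real.log (Real.exp 1 + p.2 / ‖p.1‖))⁻¹)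

end

variable {n : ℕ}

theorem integrableOn_ball_of_norm_le_const_mul_inv_pow {F : Type*} [NormedAddCommGroup F]
    {f : EuclideanSpace ℝ (Fin n) → F} {C : ℝ} {k : ℕ} (hk : k < n)
    (hf : ∀ᵐ x ∂volume.restrict (Metric.ball (0 : EuclideanSpace ℝ (Fin n)) 1),
      ‖f x‖ ≤ C * (‖x‖ ^ k)⁻¹)
    (hm : AEStronglyMeasurable f) : IntegrableOn f (Metric.ball 0 1) := by
  refine integrableOn_ball_of_norm_le_rpow (α := k) (C := C) ?_ ?_ ?_ hm
  · rw [finrank_euclideanSpace_fin]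
    omega
  · rw [finrank_euclideanSpace_fin]
    exact_mod_cast hk
  · filter_upwards [hf] with x hx
    rwa [Real.rpow_neg (norm_nonneg _), Real.rpow_natCast]

theorem measurable_witness (n : ℕ) : Measurable (witness n) := by
  unfold witness
  fun_prop

theorem witness_nonneg (x : EuclideanSpace ℝ (Fin n)) : 0 ≤ witness n x := by
  have := one_le_log_exp_one_add (t := ‖x‖⁻¹) (by positivity)
  unfold witness
  positivity

theorem witness_le (x : EuclideanSpace ℝ (Fin n)) : witness n x ≤ (‖x‖ ^ 2)⁻¹ :=
  mul_le_of_le_one_right (by positivity) (inv_log_exp_one_add_le_one (by positivity))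

theorem measurable_fluxIntegrand (ψ : EuclideanSpace ℝ (Fin n) → ℝ) :
    Measurable (fluxIntegrand ψ) := by
  have := measurable_gradient ψ
  unfold fluxIntegrand
  fun_prop

theorem norm_inner_div_norm_sq_le {F : Type*} [NormedAddCommGroup F] [InnerProductSpace ℝ F]
    (v x : F) : ‖(‖x‖ ^ 2)⁻¹ * inner ℝ v x‖ ≤ ‖v‖ * ‖x‖⁻¹ := by
  rcases eq_or_ne x 0 with rfl | hx
  · simp
  have hx' : 0 < ‖x‖ := norm_pos_iff.2 hx
  rw [norm_mul, Real.norm_of_nonneg (by positivity)]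
  calc (‖x‖ ^ 2)⁻¹ * ‖inner ℝ v x‖ ≤ (‖x‖ ^ 2)⁻¹ * (‖v‖ * ‖x‖) := by
        gcongr
        exact norm_inner_le_norm v x
    _ = _ := by field_simp

theorem IsLipZero.integrable_norm_gradient_mul_inv_norm (hn : 3 ≤ n)
    {ψ : EuclideanSpace ℝ (Fin n) → ℝ} (hψ : IsLipZero (Metric.ball 0 1) ψ) :
    Integrable fun x => ‖gradient ψ x‖ * ‖x‖⁻¹ := by
  obtain ⟨⟨K, hK⟩, hc, hs⟩ := hψ
  have h1 : IntegrableOn (fun x => ‖gradient ψ x‖ * ‖x‖⁻¹) (Metric.ball 0 1) := by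
    refine integrableOn_ball_of_norm_le_const_mul_inv_pow (C := K) (k := 1) (by omega)
      (ae_of_all _ fun x => ?_) ?_
    · rw [Real.norm_of_nonneg (by positivity), pow_one]
      gcongr
      exact hK.norm_gradient_le x
    · have := measurable_gradient ψ
      exact Measurable.aestronglyMeasurable (by fun_prop)
  rwa [integrableOn_iff_integrable_of_support_subset] at h1
  intro x hx
  by_contra hx'
  simp [gradient_eq_zero_of_notMem_tsupport fun h => hx' (hs h)] at hx

/-- The integrand is dominated by the product of |∇ψ(y)|/|y| and t^{-2}, each integrable in its own
variable. -/
theorem IsLipZero.integrable_fluxIntegrand (hn : 3 ≤ n)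
    {ψ : EuclideanSpace ℝ (Fin n) → ℝ} (hψ : IsLipZero (Metric.ball 0 1) ψ) :
    Integrable (fluxIntegrand ψ) (volume.prod (volume.restrict (Set.Ioi 1))) := by
  refine Integrable.mono'
    ((hψ.integrable_norm_gradient_mul_inv_norm hn).mul_prod integrableOn_Ioi_inv_sq)
    (measurable_fluxIntegrand ψ).aestronglyMeasurable ?_
  have h1 : ∀ᵐ p ∂((volume : Measure (EuclideanSpace ℝ (Fin n))).prod
      (volume.restrict (Set.Ioi (1 : ℝ)))), 1 < p.2 :=
    Measure.quasiMeasurePreserving_snd.ae (ae_restrict_mem measurableSet_Ioi)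
  filter_upwards [h1] with p hp
  rw [fluxIntegrand, norm_mul]
  gcongr
  · exact norm_inner_div_norm_sq_le _ _
  · rw [Real.norm_of_nonneg (profile_integrand_nonneg hp (norm_nonneg _))]
    exact profile_integrand_le hn hp (norm_nonneg _)

/-- The factor t^n is the one cancelled by the Jacobian of y = tx. -/
theorem witness_mul_inner_eq_fluxIntegrand (hn : 3 ≤ n) (ψ : EuclideanSpace ℝ (Fin n) → ℝ)
    {t : ℝ} (ht : 1 < t) (x : EuclideanSpace ℝ (Fin n)) :
    witness n x * inner ℝ (gradient ψ (t • x)) x = t ^ n * fluxIntegrand ψ (t • x, t) := by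
  have ht0 : 0 < t := one_pos.trans ht
  have h1 : t ^ n = t ^ (n - 1) * t := by
    rw [← pow_succ]
    congr 1
    omega
  rcases eq_or_ne x 0 with rfl | hx
  · simp [fluxIntegrand]
  have hx0 : 0 < ‖x‖ := norm_pos_iff.2 hx
  have h2 : t / ‖t • x‖ = ‖x‖⁻¹ := by
    rw [norm_smul, Real.norm_of_nonneg ht0.le]
    field_simp
  have h3 := one_le_log_exp_one_add (t := ‖x‖⁻¹) (by positivity)
  simp only [fluxIntegrand, witness, h2, real_inner_smul_right]
  rw [norm_smul, Real.norm_of_nonneg ht0.le, h1]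
  field_simp

theorem IsLipZero.integral_inner_gradient_solutionGradient (hn : 3 ≤ n)
    {ψ : EuclideanSpace ℝ (Fin n) → ℝ} (hψ : IsLipZero (Metric.ball 0 1) ψ) :
    ∫ x, inner ℝ (gradient ψ x) (solutionGradient n x) = ∫ x, witness n x * ψ x := by
  have : NeZero n := ⟨by omega⟩
  have hI := hψ.integrable_fluxIntegrand hn
  -- Stated for a positively homogeneous G so that it serves twice: G = ‖·‖ transfers integrability,
  -- G = `id` transfers the integral.
  have hscale : ∀ t : ℝ, 1 < t → ∀ G : ℝ → ℝ, (∀ s : ℝ, G (t ^ n * s) = t ^ n * G s) →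
      ∫ x, G (witness n x * inner ℝ (gradient ψ (t • x)) x) = ∫ y, G (fluxIntegrand ψ (y, t)) := by
    intro t ht G hG
    have ht0 : 0 < t := one_pos.trans ht
    simp_rw [witness_mul_inner_eq_fluxIntegrand hn ψ ht, hG]
    rw [integral_const_mul, Measure.integral_comp_smul volume (fun y => G (fluxIntegrand ψ (y, t))),
      finrank_euclideanSpace_fin, abs_of_pos (by positivity), smul_eq_mul, ← mul_assoc,
      mul_inv_cancel₀ (by positivity), one_mul]
  have hF : Integrable
      (Function.uncurry fun (x : EuclideanSpace ℝ (Fin n)) (t : ℝ) =>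
        witness n x * inner ℝ (gradient ψ (t • x)) x)
      (volume.prod (volume.restrict (Set.Ioi 1))) := by
    have hg := measurable_gradient ψ
    have hw := measurable_witness n
    have hm : Measurable
        (Function.uncurry fun (x : EuclideanSpace ℝ (Fin n)) (t : ℝ) =>
          witness n x * inner ℝ (gradient ψ (t • x)) x) := by
      unfold Function.uncurry
      fun_prop
    rw [integrable_prod_iff' (measurable_fluxIntegrand ψ).aestronglyMeasurable] at hI
    rw [integrable_prod_iff' hm.aestronglyMeasurable]
    constructor
    · filter_upwards [hI.1, ae_restrict_mem measurableSet_Ioi] with t ht ht1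
      simp only [Function.uncurry, witness_mul_inner_eq_fluxIntegrand hn ψ ht1]
      exact (ht.comp_smul (one_pos.trans ht1).ne').const_mul _
    · refine hI.2.congr ?_
      filter_upwards [ae_restrict_mem measurableSet_Ioi] with t ht1
      refine (hscale t ht1 (fun s => ‖s‖) fun s => ?_).symm
      rw [norm_mul, Real.norm_of_nonneg (by have := one_pos.trans (Set.mem_Ioi.1 ht1); positivity)]
  have e1 : ∫ x, witness n x * ψ x =
      -∫ x, ∫ t in Set.Ioi (1 : ℝ), witness n x * inner ℝ (gradient ψ (t • x)) x := by
    obtain ⟨⟨K, hK⟩, -, hs⟩ := hψ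
    rw [← integral_neg]
    refine integral_congr_ae ?_
    filter_upwards [hK.ae_integral_Ioi_inner_gradient_smul hs] with x hx
    rw [integral_const_mul, hx]
    ring
  have e2 : ∀ t ∈ Set.Ioi (1 : ℝ), ∫ x, witness n x * inner ℝ (gradient ψ (t • x)) x =
      ∫ y, fluxIntegrand ψ (y, t) := fun t ht => hscale t ht id fun s => rfl
  rw [e1, integral_integral_swap hF, setIntegral_congr_fun measurableSet_Ioi e2]
  rw [← integral_integral_swap (f := fun y t => fluxIntegrand ψ (y, t)) hI, ← integral_neg]
  refine integral_congr_ae (ae_of_all _ fun y => ?_)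
  simp only [fluxIntegrand, solutionGradient]
  rw [integral_const_mul, real_inner_smul_right]
  simp only [profile]
  ring

theorem IsLipZero.integrableOn_witness_mul (hn : 3 ≤ n)
    {ψ : EuclideanSpace ℝ (Fin n) → ℝ} (hψ : IsLipZero (Metric.ball 0 1) ψ) :
    IntegrableOn (fun x => witness n x * ψ x) (Metric.ball 0 1) := by
  obtain ⟨⟨K, hK⟩, hc, hs⟩ := hψ
  obtain ⟨M, hM⟩ := hc.exists_bound_of_continuous hK.continuous
  refine integrableOn_ball_of_norm_le_const_mul_inv_pow (C := M) (k := 2) (by omega)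
    (ae_of_all _ fun x => ?_)
    ((measurable_witness n).mul hK.continuous.measurable).aestronglyMeasurable
  rw [norm_mul, mul_comm, Real.norm_of_nonneg (witness_nonneg x)]
  exact mul_le_mul (hM x) (witness_le x) (witness_nonneg x) ((norm_nonneg _).trans (hM x))

theorem IsLipZero.weak_formulation (hn : 3 ≤ n)
    {ψ : EuclideanSpace ℝ (Fin n) → ℝ} (hψ : IsLipZero (Metric.ball 0 1) ψ) :
    ∫ x in Metric.ball 0 1, inner ℝ (gradient ψ x) (solutionGradient n x) =
      ∫ x in Metric.ball 0 1, witness n x * ψ x := by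
  rw [setIntegral_eq_integral_of_forall_compl_eq_zero,
    setIntegral_eq_integral_of_forall_compl_eq_zero,
    hψ.integral_inner_gradient_solutionGradient hn]
  · intro x hx
    rw [image_eq_zero_of_notMem_tsupport fun h => hx (hψ.2.2 h), mul_zero]
  · intro x hx
    rw [gradient_eq_zero_of_notMem_tsupport fun h => hx (hψ.2.2 h), inner_zero_left]

end PoissonOrlicz

/-! ### Membership of the solution in H^1_0 by truncation, and its unboundedness. -/

theorem tendsto_eLpNorm_two_of_dominated {X F : Type*} [MeasurableSpace X] {μ : Measure X}
    [NormedAddCommGroup F] {c : ℕ → X → F} {G : X → ℝ} (hc : ∀ j, AEStronglyMeasurable (c j) μ)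
    (hG : MemLp G 2 μ) (hle : ∀ j, ∀ᵐ x ∂μ, ‖c j x‖ ≤ G x)
    (hlim : ∀ᵐ x ∂μ, Tendsto (fun j => c j x) atTop (𝓝 0)) :
    Tendsto (fun j => eLpNorm (c j) 2 μ) atTop (𝓝 0) := by
  simp only [eLpNorm_eq_lintegral_rpow_enorm_toReal two_ne_zero ENNReal.ofNat_ne_top,
    ENNReal.toReal_ofNat]
  have h := tendsto_lintegral_of_dominated_convergence' (μ := μ)
    (F := fun j x => ‖c j x‖ₑ ^ (2 : ℝ)) (f := fun _ => 0) (fun x => ‖G x‖ₑ ^ (2 : ℝ))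
    (fun j => (hc j).enorm.pow_const _) (fun j => ?_) ?_ ?_
  · rw [lintegral_zero] at h
    simpa using h.ennrpow_const (1 / 2)
  · filter_upwards [hle j] with x hx
    gcongr
    rw [enorm_le_iff_norm_le]
    exact hx.trans (le_abs_self _)
  · have := hG.eLpNorm_lt_top
    rw [eLpNorm_lt_top_iff_lintegral_rpow_enorm_lt_top two_ne_zero ENNReal.ofNat_ne_top] at this
    exact this.ne
  · filter_upwards [hlim] with x hx
    simpa using (hx.enorm).ennrpow_const 2

namespace PoissonOrlicz

noncomputable section

/-- The solution, made constant inside the ball of radius `a` and cut off outside the ball of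
radius `b`. -/
def truncatedSolution (n : ℕ) (a b : ℝ) (x : EuclideanSpace ℝ (Fin n)) : ℝ :=
  radialSol n (max a (min b ‖x‖)) - radialSol n b

end

variable {n : ℕ} {a b : ℝ}

/-- On [a, b] one has |u'| = W(r)/r ≤ 1/a, and both clamping to [a, b] and the norm are 1-Lipschitz.
-/
theorem lipschitzWith_truncatedSolution (hn : 3 ≤ n) (ha : 0 < a) (hab : a ≤ b) :
    LipschitzWith (a⁻¹).toNNReal (truncatedSolution n a b) := by
  have h1 : LipschitzOnWith (a⁻¹).toNNReal (radialSol n) (Set.Icc a b) := by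
    refine (convex_Icc a b).lipschitzOnWith_of_nnnorm_hasDerivWithin_le
      (fun r hr => (hasDerivAt_radialSol hn (ha.trans_le hr.1)).hasDerivWithinAt) fun r hr => ?_
    have hr0 : 0 < r := ha.trans_le hr.1
    rw [← NNReal.coe_le_coe, coe_nnnorm, Real.coe_toNNReal _ (by positivity), norm_neg,
      Real.norm_of_nonneg (div_nonneg (profile_nonneg hr0.le) hr0.le), ← one_div]
    exact div_le_div₀ zero_le_one (profile_le_one hn hr0.le) ha hr.1
  have h2 := ((lipschitzOnWith_iff_restrict.1 h1).comp (LipschitzWith.projIcc hab)).comp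
    (lipschitzWith_one_norm (E := EuclideanSpace ℝ (Fin n)))
  have h3 := h2.sub (LipschitzWith.const (radialSol n b))
  rw [mul_one, mul_one, add_zero] at h3
  exact h3

theorem truncatedSolution_of_le (hab : a ≤ b) {x : EuclideanSpace ℝ (Fin n)} (hx : b ≤ ‖x‖) :
    truncatedSolution n a b x = 0 := by
  simp [truncatedSolution, hx, hab]

theorem truncatedSolution_of_mem {x : EuclideanSpace ℝ (Fin n)} (hax : a ≤ ‖x‖) (hxb : ‖x‖ ≤ b) :
    truncatedSolution n a b x = solution n x - radialSol n b := by
  simp [truncatedSolution, solution, hax, hxb]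

theorem isLipZero_truncatedSolution (hn : 3 ≤ n) (ha : 0 < a) (hab : a ≤ b) (hb : b < 1) :
    IsLipZero (Metric.ball 0 1) (truncatedSolution n a b) := by
  have hs : tsupport (truncatedSolution n a b) ⊆ Metric.closedBall 0 b := by
    refine closure_minimal (fun x hx => ?_) Metric.isClosed_closedBall
    rw [mem_closedBall_zero_iff]
    by_contra h
    exact hx (truncatedSolution_of_le hab (not_le.1 h).le)
  exact ⟨⟨_, lipschitzWith_truncatedSolution hn ha hab⟩,
    HasCompactSupport.of_support_subset_isCompact (isCompact_closedBall 0 b)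
      ((subset_tsupport _).trans hs), hs.trans (Metric.closedBall_subset_ball hb)⟩

theorem hasGradientAt_solution (hn : 3 ≤ n) {x : EuclideanSpace ℝ (Fin n)} (hx : x ≠ 0) :
    HasGradientAt (solution n) (solutionGradient n x) x := by
  have hx0 : 0 < ‖x‖ := norm_pos_iff.2 hx
  have h1 : HasFDerivAt (fun y : EuclideanSpace ℝ (Fin n) => ‖y‖) (‖x‖⁻¹ • innerSL ℝ x) x := by
    have h2 := (hasStrictFDerivAt_norm_sq x).hasFDerivAt.sqrt (by positivity)
    simp only [Real.sqrt_sq (norm_nonneg _)] at h2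
    convert! h2 using 1
    ext y
    simp
    field_simp
  rw [hasGradientAt_iff_hasFDerivAt]
  convert! (hasDerivAt_radialSol hn hx0).comp_hasFDerivAt x h1 using 1
  ext y
  simp [solutionGradient]
  field_simp

theorem gradient_truncatedSolution_of_lt (hab : a < b) {x : EuclideanSpace ℝ (Fin n)}
    (hx : ‖x‖ < a) : gradient (truncatedSolution n a b) x = 0 := by
  have : truncatedSolution n a b =ᶠ[𝓝 x] fun _ => radialSol n a - radialSol n b := by
    filter_upwards [(isOpen_lt continuous_norm continuous_const).mem_nhds hx] with y hy
    have hy' : ‖y‖ < a := hy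
    simp [truncatedSolution, hy'.le, (hy'.trans hab).le]
  rw [this.gradient_eq, gradient_fun_const]

theorem gradient_truncatedSolution_of_gt (hab : a ≤ b) {x : EuclideanSpace ℝ (Fin n)}
    (hx : b < ‖x‖) : gradient (truncatedSolution n a b) x = 0 := by
  have : truncatedSolution n a b =ᶠ[𝓝 x] fun _ => 0 := by
    filter_upwards [(isOpen_lt continuous_const continuous_norm).mem_nhds hx] with y hy
    exact truncatedSolution_of_le hab (le_of_lt hy)
  rw [this.gradient_eq, gradient_fun_const]

theorem gradient_truncatedSolution_of_mem (hn : 3 ≤ n) (ha : 0 < a)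
    {x : EuclideanSpace ℝ (Fin n)} (hax : a < ‖x‖) (hxb : ‖x‖ < b) :
    gradient (truncatedSolution n a b) x = solutionGradient n x := by
  have : truncatedSolution n a b =ᶠ[𝓝 x] fun y => solution n y - radialSol n b := by
    filter_upwards [(isOpen_lt continuous_const continuous_norm).mem_nhds hax,
      (isOpen_lt continuous_norm continuous_const).mem_nhds hxb] with y hy1 hy2
    exact truncatedSolution_of_mem (le_of_lt hy1) (le_of_lt hy2)
  rw [this.gradient_eq]
  have h1 := hasGradientAt_solution hn (norm_pos_iff.1 (ha.trans hax))
  rw [hasGradientAt_iff_hasFDerivAt] at h1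
  exact (hasGradientAt_iff_hasFDerivAt.2 (h1.sub_const (radialSol n b))).gradient

theorem solution_nonneg {x : EuclideanSpace ℝ (Fin n)} (hx : ‖x‖ ≤ 1) : 0 ≤ solution n x :=
  radialSol_nonneg (norm_nonneg _) hx

/-- By monotonicity the truncation lies between 0 and u, so the error is at most u ≤ 1/|x|. -/
theorem norm_truncatedSolution_sub_solution_le (hn : 3 ≤ n) (ha : 0 < a) (hab : a ≤ b)
    (hb : b ≤ 1) {x : EuclideanSpace ℝ (Fin n)} (hx0 : x ≠ 0) (hx : ‖x‖ ≤ 1) :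
    ‖truncatedSolution n a b x - solution n x‖ ≤ ‖x‖⁻¹ := by
  have hxp : 0 < ‖x‖ := norm_pos_iff.2 hx0
  have hanti := antitoneOn_radialSol hn
  have hbp := ha.trans_le hab
  have h1 : radialSol n ‖x‖ ≤ ‖x‖⁻¹ := radialSol_le_inv hn hxp hx
  have h2 : 0 ≤ radialSol n b := radialSol_nonneg hbp.le hb
  have h5 : 0 ≤ radialSol n ‖x‖ := radialSol_nonneg (norm_nonneg _) hx
  have h3 : radialSol n b ≤ radialSol n (max a (min b ‖x‖)) :=
    hanti (Set.mem_Ioi.2 (lt_max_of_lt_left ha)) hbp (max_le hab (min_le_left _ _))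
  have h4 : radialSol n (max a (min b ‖x‖)) ≤ radialSol n ‖x‖ + radialSol n b := by
    rcases le_total b ‖x‖ with h | h
    · rw [min_eq_left h, max_eq_right hab]
      linarith
    · rw [min_eq_right h]
      have := hanti hxp (Set.mem_Ioi.2 (lt_max_of_lt_left ha)) (le_max_right a ‖x‖)
      linarith
  rw [truncatedSolution, solution, Real.norm_eq_abs, abs_le]
  constructor <;> linarith

theorem norm_solutionGradient_le (hn : 3 ≤ n) (x : EuclideanSpace ℝ (Fin n)) :
    ‖solutionGradient n x‖ ≤ ‖x‖⁻¹ := by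
  rcases eq_or_ne x 0 with rfl | hx
  · simp [solutionGradient]
  have hx0 : 0 < ‖x‖ := norm_pos_iff.2 hx
  rw [solutionGradient, norm_smul, norm_neg,
    Real.norm_of_nonneg (div_nonneg (profile_nonneg hx0.le) (by positivity))]
  calc profile n ‖x‖ / ‖x‖ ^ 2 * ‖x‖ ≤ 1 / ‖x‖ ^ 2 * ‖x‖ := by
        gcongr
        exact profile_le_one hn hx0.le
    _ = _ := by field_simp

theorem aestronglyMeasurable_of_continuousOn_compl_zero [NeZero n] {F : Type*}
    [TopologicalSpace F] [TopologicalSpace.PseudoMetrizableSpace F]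
    [SecondCountableTopologyEither (EuclideanSpace ℝ (Fin n)) F]
    {φ : EuclideanSpace ℝ (Fin n) → F} (h : ContinuousOn φ {0}ᶜ) :
    AEStronglyMeasurable φ volume := by
  have h1 := h.aestronglyMeasurable (μ := volume) (measurableSet_singleton _).compl
  rwa [restrict_compl_singleton] at h1

theorem ContinuousOn.comp_norm_compl_zero {φ : ℝ → ℝ} (h : ContinuousOn φ (Set.Ioi 0)) :
    ContinuousOn (fun x : EuclideanSpace ℝ (Fin n) => φ ‖x‖) {0}ᶜ :=
  h.comp continuous_norm.continuousOn fun _ hx => norm_pos_iff.2 hx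

theorem memLp_inv_norm (hn : 3 ≤ n) :
    MemLp (fun x : EuclideanSpace ℝ (Fin n) => ‖x‖⁻¹) 2
      (volume.restrict (Metric.ball 0 1)) := by
  have hm : Measurable fun x : EuclideanSpace ℝ (Fin n) => ‖x‖⁻¹ := by fun_prop
  rw [memLp_two_iff_integrable_sq hm.aestronglyMeasurable]
  exact integrableOn_ball_of_norm_le_const_mul_inv_pow (C := 1) (k := 2) (by omega)
    (ae_of_all _ fun x => by simp) (hm.pow_const 2).aestronglyMeasurable

theorem memHOneZero_solution (hn : 3 ≤ n) :
    MemHOneZero (Metric.ball 0 1) (solution n) (solutionGradient n) := by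
  have : NeZero n := ⟨by omega⟩
  have hmu : AEStronglyMeasurable (solution n) volume :=
    aestronglyMeasurable_of_continuousOn_compl_zero
      (ContinuousOn.comp_norm_compl_zero (continuousOn_radialSol hn))
  have hmg : AEStronglyMeasurable (solutionGradient n) volume := by
    refine aestronglyMeasurable_of_continuousOn_compl_zero ?_
    refine ContinuousOn.smul (ContinuousOn.neg (ContinuousOn.div
      (ContinuousOn.comp_norm_compl_zero (continuousOn_profile hn)) (by fun_prop) fun x hx => ?_))
      continuousOn_id
    exact pow_ne_zero 2 (norm_ne_zero_iff.2 hx)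
  have hball : ∀ᵐ x ∂(volume.restrict (Metric.ball (0 : EuclideanSpace ℝ (Fin n)) 1)),
      ‖x‖ < 1 := by
    filter_upwards [ae_restrict_mem Metric.isOpen_ball.measurableSet] with x hx
    exact mem_ball_zero_iff.1 hx
  have hne : ∀ᵐ x ∂(volume.restrict (Metric.ball (0 : EuclideanSpace ℝ (Fin n)) 1)), x ≠ 0 :=
    ae_restrict_of_ae (compl_mem_ae_iff.2 (measure_singleton _))
  -- The truncations may have kinks on the spheres |x| = a and |x| = b, which are null.
  have hsph : ∀ r : ℝ, ∀ᵐ x ∂(volume.restrict (Metric.ball (0 : EuclideanSpace ℝ (Fin n)) 1)),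
      ‖x‖ ≠ r := fun r => by
    filter_upwards [ae_restrict_of_ae (compl_mem_ae_iff.2
      (Measure.addHaar_sphere volume (0 : EuclideanSpace ℝ (Fin n)) r))] with x hx hxr
    exact hx (mem_sphere_zero_iff_norm.2 hxr)
  -- The radii are a_j = 1/(j+3) and b_j = 1 - a_j; the shift by 3 makes a_j < b_j already at j = 0.
  have hlim : Tendsto (fun j : ℕ => ((j : ℝ) + 3)⁻¹) atTop (𝓝 0) :=
    tendsto_inv_atTop_zero.comp (tendsto_atTop_add_const_right _ _ tendsto_natCast_atTop_atTop)
  have hlim' : Tendsto (fun j : ℕ => 1 - ((j : ℝ) + 3)⁻¹) atTop (𝓝 1) := by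
    simpa using hlim.const_sub 1
  have ha : ∀ j : ℕ, 0 < ((j : ℝ) + 3)⁻¹ := fun j => by positivity
  have hab : ∀ j : ℕ, ((j : ℝ) + 3)⁻¹ < 1 - ((j : ℝ) + 3)⁻¹ := fun j => by
    have : ((j : ℝ) + 3)⁻¹ ≤ 3⁻¹ := inv_anti₀ (by norm_num) (by linarith [j.cast_nonneg (α := ℝ)])
    linarith
  have hb : ∀ j : ℕ, 1 - ((j : ℝ) + 3)⁻¹ < 1 := fun j => by linarith [ha j]
  have hlip j := isLipZero_truncatedSolution hn (ha j) (hab j).le (hb j)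
  have hev : ∀ x : EuclideanSpace ℝ (Fin n), x ≠ 0 → ‖x‖ < 1 →
      ∀ᶠ j : ℕ in atTop, ((j : ℝ) + 3)⁻¹ < ‖x‖ ∧ ‖x‖ < 1 - ((j : ℝ) + 3)⁻¹ := fun x hx0 hx =>
    (hlim.eventually_lt_const (norm_pos_iff.2 hx0)).and (hlim'.eventually_const_lt hx)
  refine ⟨(memLp_inv_norm hn).mono hmu.restrict ?_, (memLp_inv_norm hn).mono hmg.restrict ?_,
    fun j => truncatedSolution n ((j : ℝ) + 3)⁻¹ (1 - ((j : ℝ) + 3)⁻¹), hlip, ?_, ?_⟩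
  · filter_upwards [hball, hne] with x hx hx0
    rw [Real.norm_of_nonneg (solution_nonneg hx.le), Real.norm_of_nonneg (by positivity)]
    exact radialSol_le_inv hn (norm_pos_iff.2 hx0) hx.le
  · refine ae_of_all _ fun x => ?_
    rw [norm_inv, norm_norm]
    exact norm_solutionGradient_le hn x
  · refine tendsto_eLpNorm_two_of_dominated
      (fun j => (((hlip j).memLp 2).1.sub hmu).restrict) (memLp_inv_norm hn) (fun j => ?_) ?_
    · filter_upwards [hball, hne] with x hx hx0
      exact norm_truncatedSolution_sub_solution_le hn (ha j) (hab j).le (hb j).le hx0 hx.le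
    · filter_upwards [hball, hne] with x hx hx0
      have h1 : Tendsto (fun j : ℕ => -radialSol n (1 - ((j : ℝ) + 3)⁻¹)) atTop (𝓝 0) := by
        have := (((hasDerivAt_radialSol hn one_pos).continuousAt.tendsto).comp hlim').neg
        simpa [radialSol_one] using this
      refine h1.congr' ?_
      filter_upwards [hev x hx0 hx] with j hj
      rw [truncatedSolution_of_mem hj.1.le hj.2.le]
      ring
  · refine tendsto_eLpNorm_two_of_dominated
      (fun j => (((hlip j).memLp_gradient 2).1.sub hmg).restrict) (memLp_inv_norm hn)
      (fun j => ?_) ?_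
    · filter_upwards [hsph ((j : ℝ) + 3)⁻¹, hsph (1 - ((j : ℝ) + 3)⁻¹)] with x h1 h2
      rcases lt_or_gt_of_ne h1 with h1 | h1
      · rw [gradient_truncatedSolution_of_lt (hab j) h1, zero_sub, norm_neg]
        exact norm_solutionGradient_le hn x
      rcases lt_or_gt_of_ne h2 with h2 | h2
      · rw [gradient_truncatedSolution_of_mem hn (ha j) h1 h2, sub_self, norm_zero]
        positivity
      · rw [gradient_truncatedSolution_of_gt (hab j).le h2, zero_sub, norm_neg]
        exact norm_solutionGradient_le hn x
    · filter_upwards [hball, hne] with x hx hx0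
      refine tendsto_const_nhds.congr' ?_
      filter_upwards [hev x hx0 hx] with j hj
      rw [gradient_truncatedSolution_of_mem hn (ha j) hj.1 hj.2, sub_self]

theorem isNonnegWeakSolution_solution (hn : 3 ≤ n) :
    IsNonnegWeakSolution (Metric.ball 0 1) (witness n) (solution n) (solutionGradient n) := by
  refine ⟨⟨memHOneZero_solution hn, fun ψ hψ =>
    ⟨hψ.integrableOn_witness_mul hn, hψ.weak_formulation hn⟩⟩, ?_⟩
  filter_upwards [ae_restrict_mem Metric.isOpen_ball.measurableSet] with x hx
  exact solution_nonneg (mem_ball_zero_iff.1 hx).le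

theorem eLpNorm_top_solution (hn : 3 ≤ n) :
    eLpNorm (solution n) ∞ (volume.restrict (Metric.ball 0 1)) = ∞ := by
  have : NeZero n := ⟨by omega⟩
  by_contra h
  set C := (eLpNorm (solution n) ∞ (volume.restrict (Metric.ball 0 1))).toReal with hC
  have h1 : ∀ᵐ x ∂(volume.restrict (Metric.ball (0 : EuclideanSpace ℝ (Fin n)) 1)),
      solution n x ≤ C := by
    filter_upwards [ae_le_eLpNormEssSup (f := solution n)
      (μ := volume.restrict (Metric.ball 0 1))] with x hx
    rw [← eLpNorm_exponent_top] at hx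
    have := ENNReal.toReal_mono h hx
    rw [toReal_enorm] at this
    exact (le_abs_self _).trans this
  -- If u ≤ C a.e., a whole ball around 0, on which u > C off the origin, would be null.
  have h2 := (tendsto_radialSol_atTop hn).eventually_gt_atTop C
  obtain ⟨δ, hδ, hδC⟩ := mem_nhdsGT_iff_exists_Ioo_subset.1 h2
  have hδ0 : 0 < min δ 1 := lt_min hδ one_pos
  rw [ae_restrict_iff' Metric.isOpen_ball.measurableSet] at h1
  have h3 : ∀ᵐ x : EuclideanSpace ℝ (Fin n), x ∉ Metric.ball 0 (min δ 1) := by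
    filter_upwards [h1, compl_mem_ae_iff.2 (measure_singleton (0 : EuclideanSpace ℝ (Fin n)))]
      with x hx hx0 hxb
    rw [mem_ball_zero_iff, lt_min_iff] at hxb
    have h4 : C < radialSol n ‖x‖ := hδC ⟨norm_pos_iff.2 hx0, hxb.1⟩
    exact absurd (hx (mem_ball_zero_iff.2 hxb.2)) (not_le.2 h4)
  exact (Metric.measure_ball_pos volume (0 : EuclideanSpace ℝ (Fin n)) hδ0).ne'
    (measure_eq_zero_iff_ae_notMem.2 h3)

end PoissonOrlicz

/-! ### Membership of the right-hand side in the Orlicz space. -/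

namespace PoissonOrlicz

/-- Up to a bounded factor the integrand is the derivative of log(e + 1/r)^{1-β}, which is
non-negative, and this primitive has the finite limit 0 at the origin. -/
theorem integrableOn_inv_mul_rpow_log {β : ℝ} (hβ : 1 < β) :
    IntegrableOn (fun r : ℝ => r⁻¹ * Real.log (Real.exp 1 + r⁻¹) ^ (-β)) (Set.Ioo 0 1) := by
  have hpos : ∀ r : ℝ, 0 < r → 1 ≤ Real.log (Real.exp 1 + r⁻¹) := fun r hr =>
    one_le_log_exp_one_add (by positivity)
  have hd : ∀ r : ℝ, 0 < r → HasDerivAt (fun r => Real.log (Real.exp 1 + r⁻¹) ^ (1 - β))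
      ((β - 1) * ((r * (Real.exp 1 * r + 1))⁻¹ * Real.log (Real.exp 1 + r⁻¹) ^ (-β))) r := by
    intro r hr
    convert! (hasDerivAt_log_exp_one_add_inv hr).rpow_const (p := 1 - β)
      (Or.inl (by linarith [hpos r hr])) using 1
    rw [show 1 - β - 1 = -β by ring]
    ring
  -- The value at 0 is overwritten: with 0⁻¹ = 0 the formula gives 1 there, not the limit 0.
  have hcont : ContinuousOn
      (Function.update (fun r : ℝ => Real.log (Real.exp 1 + r⁻¹) ^ (1 - β)) 0 0)
      (Set.Icc 0 1) := by
    rw [continuousOn_update_iff]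
    constructor
    · rintro r ⟨hr, hr0⟩
      exact (hd r (lt_of_le_of_ne hr.1 (Ne.symm hr0))).continuousAt.continuousWithinAt
    · intro _
      have h1 : Tendsto (fun r : ℝ => Real.log (Real.exp 1 + r⁻¹) ^ (1 - β)) (𝓝[>] 0) (𝓝 0) := by
        have := (tendsto_rpow_neg_atTop (y := β - 1) (by linarith)).comp
          tendsto_log_exp_one_add_inv
        rwa [neg_sub] at this
      refine h1.mono_left (nhdsWithin_mono _ ?_)
      rintro r ⟨hr, hr0⟩
      exact lt_of_le_of_ne hr.1 (Ne.symm hr0)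
  have hI := intervalIntegral.integrableOn_deriv_of_nonneg hcont (fun r hr =>
    (hd r hr.1).congr_of_eventuallyEq (by
      filter_upwards [Ioi_mem_nhds hr.1] with s hs
      exact Function.update_of_ne (ne_of_gt hs) _ _)) (fun r hr => by
        have := hpos r hr.1
        have := hr.1
        have : 0 < β - 1 := by linarith
        positivity)
  have hI2 := (hI.mono_set Set.Ioo_subset_Ioc_self).const_mul ((Real.exp 1 + 1) / (β - 1))
  refine Integrable.mono' hI2 (Measurable.aestronglyMeasurable (by fun_prop)) ?_
  filter_upwards [ae_restrict_mem measurableSet_Ioo] with r hr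
  have hr0 := hr.1
  have hL := hpos r hr0
  have hβ' : β - 1 ≠ 0 := by linarith
  rw [Real.norm_of_nonneg (by positivity)]
  have h1 : r⁻¹ ≤ (Real.exp 1 + 1) * (r * (Real.exp 1 * r + 1))⁻¹ := by
    rw [mul_inv, ← mul_assoc, mul_comm _ r⁻¹, mul_assoc]
    refine le_mul_of_one_le_right (by positivity) ?_
    rw [← div_eq_mul_inv, one_le_div (by positivity)]
    have := mul_le_of_le_one_right (Real.exp_pos 1).le hr.2.le
    linarith
  calc _ ≤ (Real.exp 1 + 1) * (r * (Real.exp 1 * r + 1))⁻¹ *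
        Real.log (Real.exp 1 + r⁻¹) ^ (-β) := by gcongr
    _ = _ := by field_simp

variable {n : ℕ}

theorem log_exp_one_add_sq_le {s : ℝ} (hs : 0 ≤ s) :
    Real.log (Real.exp 1 + s ^ 2) ≤ 2 * Real.log (Real.exp 1 + s) := by
  have he := Real.exp_one_gt_d9
  rw [← Real.log_rpow (by positivity)]
  apply Real.log_le_log (by positivity)
  rw [Real.rpow_two]
  nlinarith [mul_nonneg hs (Real.exp_pos 1).le]

/-- The log factor is controlled by f ≤ |x|^{-2} and log(e + s²) ≤ 2 log(e + s); the power gives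
|x|^{-n} log^{-n/2}. As n/2 ≥ 1 and l ≥ 1, l^{-n/2} ≤ l^{-1}. -/
theorem logBump_witness_div_le (hn : 3 ≤ n) {q p l : ℝ} (hqp : q ≤ p) (hp : 0 ≤ p) (hl : 1 ≤ l)
    {x : EuclideanSpace ℝ (Fin n)} (hx : x ≠ 0) :
    logBump n q (|witness n x| / l) ≤ l⁻¹ * 2 ^ p *
      ((‖x‖ ^ n)⁻¹ * Real.log (Real.exp 1 + ‖x‖⁻¹) ^ (-((n : ℝ) / 2 - p))) := by
  have hx0 : 0 < ‖x‖ := norm_pos_iff.2 hx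
  have hl0 : 0 < l := one_pos.trans_le hl
  have hL := one_le_log_exp_one_add (t := ‖x‖⁻¹) (by positivity)
  have hw := witness_nonneg x
  have hn2 : (1 : ℝ) ≤ (n : ℝ) / 2 := by
    have : (3 : ℝ) ≤ n := by exact_mod_cast hn
    linarith
  rw [abs_of_nonneg hw]
  have h0 := one_le_log_exp_one_add (t := witness n x / l) (by positivity)
  have h1 : Real.log (Real.exp 1 + witness n x / l) ^ q ≤
      2 ^ p * Real.log (Real.exp 1 + ‖x‖⁻¹) ^ p := by
    rw [← Real.mul_rpow zero_le_two (by linarith)]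
    refine (Real.rpow_le_rpow_of_exponent_le h0 hqp).trans
      (Real.rpow_le_rpow (by linarith) ?_ hp)
    refine le_trans (Real.log_le_log (by positivity) ?_)
      (log_exp_one_add_sq_le (s := ‖x‖⁻¹) (by positivity))
    gcongr
    rw [inv_pow]
    exact (div_le_self hw hl).trans (witness_le x)
  have h2 : (witness n x / l) ^ ((n : ℝ) / 2) ≤
      l⁻¹ * ((‖x‖ ^ n)⁻¹ * Real.log (Real.exp 1 + ‖x‖⁻¹) ^ (-((n : ℝ) / 2))) := by
    have e1 : l⁻¹ ^ ((n : ℝ) / 2) ≤ l⁻¹ :=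
      (Real.rpow_le_rpow_of_exponent_ge (by positivity) (inv_le_one_of_one_le₀ hl) hn2).trans_eq
        (Real.rpow_one _)
    have e2 : (‖x‖ ^ 2)⁻¹ ^ ((n : ℝ) / 2) = (‖x‖ ^ n)⁻¹ := by
      rw [Real.inv_rpow (by positivity), ← Real.rpow_natCast_mul (norm_nonneg x), Nat.cast_ofNat,
        mul_div_cancel₀ _ two_ne_zero, Real.rpow_natCast]
    have e3 : (Real.log (Real.exp 1 + ‖x‖⁻¹))⁻¹ ^ ((n : ℝ) / 2) =
        Real.log (Real.exp 1 + ‖x‖⁻¹) ^ (-((n : ℝ) / 2)) := by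
      rw [Real.inv_rpow (by linarith), ← Real.rpow_neg (by linarith)]
    rw [div_eq_mul_inv, mul_comm, Real.mul_rpow (by positivity) hw, witness,
      Real.mul_rpow (by positivity) (by positivity), e2, e3]
    gcongr
  calc logBump n q (witness n x / l)
      ≤ (l⁻¹ * ((‖x‖ ^ n)⁻¹ * Real.log (Real.exp 1 + ‖x‖⁻¹) ^ (-((n : ℝ) / 2)))) *
        (2 ^ p * Real.log (Real.exp 1 + ‖x‖⁻¹) ^ p) := by
        unfold logBump
        gcongr
    _ = l⁻¹ * 2 ^ p * ((‖x‖ ^ n)⁻¹ * (Real.log (Real.exp 1 + ‖x‖⁻¹) ^ (-((n : ℝ) / 2)) *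
          Real.log (Real.exp 1 + ‖x‖⁻¹) ^ p)) := by ring
    _ = _ := by
        rw [← Real.rpow_add (by linarith)]
        ring_nf

theorem memOrlicz_witness (hn : 3 ≤ n) {q : ℝ} (hq : q < (n : ℝ) / 2 - 1) :
    MemOrlicz (logBump n q) (witness n)
      (volume.restrict (Metric.ball (0 : EuclideanSpace ℝ (Fin n)) 1)) := by
  have : NeZero n := ⟨by omega⟩
  refine ⟨(measurable_witness n).aestronglyMeasurable, ?_⟩
  -- An upper bound for the logarithm bounds its power only for a non-negative exponent; replacing q
  -- by max(q, 0) keeps p < n/2 - 1 because n ≥ 3.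
  set p := max q 0 with hp
  have hpn : p < (n : ℝ) / 2 - 1 := by
    have : (3 : ℝ) ≤ n := by exact_mod_cast hn
    exact max_lt hq (by linarith)
  set H : EuclideanSpace ℝ (Fin n) → ℝ := fun x =>
    (‖x‖ ^ n)⁻¹ * Real.log (Real.exp 1 + ‖x‖⁻¹) ^ (-((n : ℝ) / 2 - p)) with hH
  have hH0 : ∀ x, 0 ≤ H x := fun x => by
    have := one_le_log_exp_one_add (t := ‖x‖⁻¹) (by positivity)
    positivity
  have hHI : IntegrableOn H (Metric.ball 0 1) := by
    -- In polar coordinates the weight r^{n-1} turns r^{-n} into r^{-1}.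
    refine (integrableOn_fun_norm_addHaar volume
      (f := fun r => (r ^ n)⁻¹ * Real.log (Real.exp 1 + r⁻¹) ^ (-((n : ℝ) / 2 - p)))).2 ?_
    refine (integrableOn_inv_mul_rpow_log (β := (n : ℝ) / 2 - p) (by linarith)).congr_fun
      (fun r hr => ?_) measurableSet_Ioo
    have hr0 : r ≠ 0 := hr.1.ne'
    have h1 : r ^ n = r ^ (n - 1) * r := by
      rw [← pow_succ]
      congr 1
      omega
    simp only [finrank_euclideanSpace_fin, smul_eq_mul]
    rw [h1]
    field_simp
  set I := ∫ x in Metric.ball 0 1, H x with hI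
  have hI0 : 0 ≤ I := integral_nonneg hH0
  -- Chosen so that l^{-1} 2^p I ≤ 1, which makes l admissible in the Luxemburg norm.
  set l := max 1 (2 ^ p * I) with hl
  have hl1 : 1 ≤ l := le_max_left _ _
  have hl0 : 0 < l := one_pos.trans_le hl1
  have hadm : ∫⁻ x in Metric.ball (0 : EuclideanSpace ℝ (Fin n)) 1,
      ENNReal.ofReal (logBump n q (|witness n x| / l)) ≤ 1 := by
    calc _ ≤ ∫⁻ x in Metric.ball (0 : EuclideanSpace ℝ (Fin n)) 1,
          ENNReal.ofReal (l⁻¹ * 2 ^ p * H x) := by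
          refine lintegral_mono_ae ?_
          filter_upwards [ae_restrict_of_ae (compl_mem_ae_iff.2
            (measure_singleton (0 : EuclideanSpace ℝ (Fin n))))] with x hx
          exact ENNReal.ofReal_le_ofReal
            (logBump_witness_div_le hn (le_max_left _ _) (le_max_right _ _) hl1 hx)
      _ = ENNReal.ofReal (l⁻¹ * 2 ^ p * I) := by
          rw [← ofReal_integral_eq_lintegral_ofReal (hHI.const_mul _)
            (ae_of_all _ fun x => mul_nonneg (by positivity) (hH0 x)), integral_const_mul]
      _ ≤ 1 := by
          rw [ENNReal.ofReal_le_one, mul_assoc, inv_mul_le_iff₀ hl0, mul_one]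
          exact le_max_right _ _
  unfold luxemburgNorm
  exact (iInf_le_of_le l (iInf_le_of_le hl0 (iInf_le_of_le hadm le_rfl))).trans_lt
    ENNReal.ofReal_lt_top

end PoissonOrlicz

theorem mainTheorem4 (n : ℕ) (hn : 3 ≤ n) (q : ℝ) (hq : q < (n : ℝ) / 2 - 1) :
    (∃ f : EuclideanSpace ℝ (Fin n) → ℝ,
      f = PoissonOrlicz.witness n ∧
      PoissonOrlicz.MemOrlicz (PoissonOrlicz.logBump n q) f
        (volume.restrict (Metric.ball (0 : EuclideanSpace ℝ (Fin n)) 1)) ∧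
      ∃ (u : EuclideanSpace ℝ (Fin n) → ℝ)
        (g : EuclideanSpace ℝ (Fin n) → EuclideanSpace ℝ (Fin n)),
        PoissonOrlicz.IsNonnegWeakSolution
          (Metric.ball (0 : EuclideanSpace ℝ (Fin n)) 1) f u g ∧
        (∀ (w : EuclideanSpace ℝ (Fin n) → ℝ)
          (h : EuclideanSpace ℝ (Fin n) → EuclideanSpace ℝ (Fin n)),
          PoissonOrlicz.IsWeakSolution
            (Metric.ball (0 : EuclideanSpace ℝ (Fin n)) 1) f w h →
          w =ᵐ[volume.restrict (Metric.ball (0 : EuclideanSpace ℝ (Fin n)) 1)] u ∧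
          h =ᵐ[volume.restrict (Metric.ball (0 : EuclideanSpace ℝ (Fin n)) 1)] g) ∧
        eLpNorm u ∞ (volume.restrict (Metric.ball (0 : EuclideanSpace ℝ (Fin n)) 1)) = ∞) ∧
    ¬ ∃ C : ℝ≥0, ∀ (f u : EuclideanSpace ℝ (Fin n) → ℝ)
        (g : EuclideanSpace ℝ (Fin n) → EuclideanSpace ℝ (Fin n)),
        PoissonOrlicz.MemOrlicz (PoissonOrlicz.logBump n q) f
          (volume.restrict (Metric.ball (0 : EuclideanSpace ℝ (Fin n)) 1)) →
        PoissonOrlicz.IsNonnegWeakSolution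
          (Metric.ball (0 : EuclideanSpace ℝ (Fin n)) 1) f u g →
        eLpNorm u ∞ (volume.restrict (Metric.ball (0 : EuclideanSpace ℝ (Fin n)) 1)) ≤
          C * PoissonOrlicz.luxemburgNorm (PoissonOrlicz.logBump n q) f
            (volume.restrict (Metric.ball (0 : EuclideanSpace ℝ (Fin n)) 1)) := by
  have : NeZero n := ⟨by omega⟩
  have hf := PoissonOrlicz.memOrlicz_witness hn hq
  have hu := PoissonOrlicz.isNonnegWeakSolution_solution hn
  have htop := PoissonOrlicz.eLpNorm_top_solution hn
  refine ⟨⟨_, rfl, hf, _, _, hu, fun w h hw => hw.unique hu.1, htop⟩, ?_⟩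
  rintro ⟨C, hC⟩
  have h := hC _ _ _ hf hu
  rw [htop, top_le_iff] at h
  exact ENNReal.mul_ne_top ENNReal.coe_ne_top hf.2.ne h
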